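/- Let $\mathbb S$ be the category of sets and $\mathbb F$ its full subcategory of finite sets, with cartesian product $\times$ and exponentials $X\to Y$, terminal object $1$, left unitor $\lambda_X:1\times X\to X$, right unitor $\rho_X:X\times 1\to X$, associativity isomorphism $\alpha_{A,B,C}:A\times(B\times C)\to(A\times B)\times C$, and evaluation $\mathrm{ev}:(X\to Y)\times X\to Y$. Let $[\mathbb F,\mathbb S]$ be the category of functors $\mathbb F\to\mathbb S$ and natural transformations, monoidal under Day convolution of the cartesian product, $(F\star G)(X)=\int^{C\in\mathbb F}F(C)\times G(C\to X)$, with unit the inclusion $\mathbb F\to\mathbb S$. A strong endoprofunctor is a pair $(P,\mathrm{str})$ of a functor $P:\mathbb F^{op}\times\mathbb F\to\mathbb S$ and maps $\mathrm{str}_{X,Y,Z}:P(X,Y)\to P(X\times Z,Y\times Z)$, natural in $X$ and $Y$ and dinatural in $Z$, such that $P(\mathrm{id},\rho_Y)\circ\mathrm{str}_{X,Y,1}=P(\rho_X,\mathrm{id})$ and $\mathrm{str}_{X\times V,Y\times V,W}\circ\mathrm{str}_{X,Y,V}=P(\alpha^{-1},\alpha)\circ\mathrm{str}_{X,Y,V\times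 W}$. A strong natural transformation is a natural transformation that commutes with the strengths. These form a category $\mathbf{Prof}_s$, which is monoidal under Bénabou's tensor: $(P\otimes Q)(X,Y)=\int^{W\in\mathbb F}P(X,W)\times Q(W,Y)$, with the strength determined by $\mathrm{str}_Z\circ\iota_W=\iota_{W\times Z}\circ(\mathrm{str}^P_Z\times\mathrm{str}^Q_Z)$, where the $\iota$ are the coend injections. The unit is $\mathrm{Hom}_{\mathbb F}$ with strength $f\mapsto f\times\mathrm{id}_Z$, and the associator and unitors are the canonical ones. The Cayley functor $(-)^!:[\mathbb F,\mathbb S]\to\mathbf{Prof}_s$ sends $F$ to $F^!(X,Y)=F(X\to Y)$, with strength $F(X\to Y)\to F(X\times Z\to Y\times Z)$ the image under $F$ of the transpose of $(\mathrm{ev}\times\mathrm{id}_Z)\circ\alpha:(X\to Y)\times(X\times Z)\to Y\times Z$. The restriction functor $(-)_*:\mathbf{Prof}_s\to[\mathbb F,\mathbb S]$ sends $P$ to $P_*(Z)=P(1,Z)$. There is an adjunction $(-)^!\dashv(-)_*$ (the Cayley adjunction). Its unit $F(Z)\to F(1\to Z)$ is the image under $F$ of the transpose of $\rho_Z$. Its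 counit is $P(\lambda_X^{-1},\mathrm{ev})\circ\mathrm{str}_{1,\,X\to Y,\,X}:P(1,X\to Y)\to P(X,Y)$. **Proposition.** The Cayley functor $(-)^!$ is strong monoidal, the restriction functor $(-)_*$ is lax monoidal, and the Cayley adjunction is a monoidal adjunction. That is, there are a strong monoidal structure on $(-)^!$ and a lax monoidal structure on $(-)_*$ for which both the unit and the counit of the adjunction $(-)^!\dashv(-)_*$ are monoidal natural transformations. -/

import Mathlib

open CategoryTheory MonoidalCategory Limits Opposite
open scoped CategoryTheory.Prod
universe u

/-- The terminal object of finite sets: the one-point set. -/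
abbrev FintypeCat.one : FintypeCat.{u} := FintypeCat.of PUnit.{u + 1}

/-- The cartesian product `X × Y` of finite sets. -/
abbrev FintypeCat.times (X Y : FintypeCat.{u}) : FintypeCat.{u} := FintypeCat.of (X × Y)

/-- The cartesian monoidal structure on finite sets. -/
instance FintypeCat.cartesianMonoidal : CartesianMonoidalCategory FintypeCat.{u} where
  tensorObj X Y := FintypeCat.times X Y
  tensorUnit := FintypeCat.one
  __ := CartesianMonoidalCategory.ofChosenFiniteProducts
    (C := FintypeCat.{u})
    { cone := asEmptyCone FintypeCat.one
      isLimit := IsTerminal.ofUniqueHom (fun _ => FintypeCat.homMk fun _ => PUnit.unit)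
        fun _ _ => by ext }
    fun X Y =>
      { cone := BinaryFan.mk (P := FintypeCat.times X Y)
          (FintypeCat.homMk Prod.fst) (FintypeCat.homMk Prod.snd)
        isLimit := BinaryFan.IsLimit.mk _ (fun f g => FintypeCat.homMk fun t => (f t, g t))
          (fun _ _ => rfl) (fun _ _ => rfl)
          (fun f g m h₁ h₂ => by subst h₁ h₂; rfl) }


/-! ### The category of finite sets is essentially small, so the Day convolution exists -/

instance FintypeCat.essentiallySmall : EssentiallySmall.{u} FintypeCat.{u} :=
  .mk' FintypeCat.Skeleton.equivalence.symm

instance FintypeCat.essentiallySmall_prod :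
    EssentiallySmall.{u} (FintypeCat.{u} × FintypeCat.{u}) :=
  .mk' ((equivSmallModel.{u} FintypeCat.{u}).prod (equivSmallModel.{u} FintypeCat.{u}))

instance FintypeCat.essentiallySmall_prod₃ :
    EssentiallySmall.{u} ((FintypeCat.{u} × FintypeCat.{u}) × FintypeCat.{u}) :=
  .mk' ((equivSmallModel.{u} (FintypeCat.{u} × FintypeCat.{u})).prod
    (equivSmallModel.{u} FintypeCat.{u}))

instance FintypeCat.essentiallySmall_prod_one :
    EssentiallySmall.{u} (FintypeCat.{u} × Discrete PUnit.{1}) :=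
  .mk' ((equivSmallModel.{u} FintypeCat.{u}).prod
    (equivSmallModel.{u} (Discrete PUnit.{1})))

theorem FintypeCat.hasColimitsOfShape_type (J : Type*) [Category J]
    [EssentiallySmall.{u} J] : HasColimitsOfShape J (Type u) :=
  Limits.hasColimitsOfShape_of_essentiallySmall.{u} J (Type u)

theorem FintypeCat.preservesColimitsOfShape_type (J : Type*) [Category J]
    [EssentiallySmall.{u} J] (T : Type u ⥤ Type u) [PreservesColimitsOfSize.{u, u} T] :
    PreservesColimitsOfShape J T :=
  preservesColimitsOfShape_of_equiv (equivSmallModel.{u} J).symm T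

open scoped MonoidalCategory.ExternalProduct in
instance FintypeCat.hasDayConvolution (F G : FintypeCat.{u} ⥤ Type u) :
    (tensor FintypeCat.{u}).HasPointwiseLeftKanExtension (F ⊠ G) :=
  fun d =>
    have := FintypeCat.hasColimitsOfShape_type.{u} (CostructuredArrow (tensor FintypeCat.{u}) d)
    inferInstanceAs (HasColimit _)

instance FintypeCat.hasDayConvolutionUnit :
    (Functor.fromPUnit.{0} (𝟙_ FintypeCat.{u})).HasPointwiseLeftKanExtension
      (Functor.fromPUnit.{0} (𝟙_ (Type u))) :=
  fun d =>
    have := FintypeCat.hasColimitsOfShape_type.{u}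
      (CostructuredArrow (Functor.fromPUnit.{0} (𝟙_ FintypeCat.{u})) d)
    inferInstanceAs (HasColimit _)

instance FintypeCat.preservesColimits_tensorLeft (J : Type*) [Category J]
    [EssentiallySmall.{u} J] (v : Type u) : PreservesColimitsOfShape J (tensorLeft v) :=
  FintypeCat.preservesColimitsOfShape_type.{u} J _

instance FintypeCat.preservesColimits_tensorRight (J : Type*) [Category J]
    [EssentiallySmall.{u} J] (v : Type u) : PreservesColimitsOfShape J (tensorRight v) :=
  FintypeCat.preservesColimitsOfShape_type.{u} J _

/-- The monoidal category `[𝔽, 𝕊]_⋆`: functors from finite sets to sets and natural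
transformations, with the Day convolution of the cartesian product of finite sets. -/
abbrev FinitaryDay : Type (u + 1) := DayFunctor FintypeCat.{u} (Type u)

/-! ### Endoprofunctors on finite sets and their composition -/

/-- The category `[𝔽ᵒᵖ × 𝔽, 𝕊]` of endoprofunctors on finite sets. -/
abbrev Endoprof : Type (u + 1) := FintypeCat.{u}ᵒᵖ × FintypeCat.{u} ⥤ Type u

namespace Endoprof

/-- The set `P(X, Y)`. -/
abbrev El (P : Endoprof.{u}) (X Y : FintypeCat.{u}) : Type u := P.obj (op X, Y)

/-- The action `P(f, g) : P(X, Y) → P(X', Y')`, contravariant in `f` and covariant in `g`. -/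
def act (P : Endoprof.{u}) {X X' Y Y' : FintypeCat.{u}} (f : X' ⟶ X) (g : Y ⟶ Y')
    (p : P.El X Y) : P.El X' Y' :=
  P.map (X := (op X, Y)) (Y := (op X', Y')) (f.op, g) p

@[simp]
theorem act_id (P : Endoprof.{u}) {X Y : FintypeCat.{u}} (p : P.El X Y) :
    P.act (𝟙 X) (𝟙 Y) p = p := by
  have h := P.map_id (op X, Y)
  exact congrArg (fun k : P.obj (op X, Y) ⟶ P.obj (op X, Y) => k p) h

@[simp]
theorem act_act (P : Endoprof.{u}) {X X' X'' Y Y' Y'' : FintypeCat.{u}} (f : X' ⟶ X)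
    (f' : X'' ⟶ X') (g : Y ⟶ Y') (g' : Y' ⟶ Y'') (p : P.El X Y) :
    P.act f' g' (P.act f g p) = P.act (f' ≫ f) (g ≫ g') p := by
  have h := P.map_comp (X := (op X, Y)) (Y := (op X', Y')) (Z := (op X'', Y'')) (f.op, g)
    (f'.op, g')
  exact (congrArg (fun k : P.obj (op X, Y) ⟶ P.obj (op X'', Y'') => k p) h).symm

/-- The component at `(X, Y)` of a natural transformation. -/
def ap {P Q : Endoprof.{u}} (τ : P ⟶ Q) {X Y : FintypeCat.{u}} (p : P.El X Y) : Q.El X Y :=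
  τ.app (op X, Y) p

@[simp]
theorem ap_act {P Q : Endoprof.{u}} (τ : P ⟶ Q) {X X' Y Y' : FintypeCat.{u}} (f : X' ⟶ X)
    (g : Y ⟶ Y') (p : P.El X Y) : ap τ (P.act f g p) = Q.act f g (ap τ p) := by
  have h := τ.naturality (X := (op X, Y)) (Y := (op X', Y')) (f.op, g)
  exact congrArg (fun k : P.obj (op X, Y) ⟶ Q.obj (op X', Y') => k p) h

@[simp]
theorem ap_id (P : Endoprof.{u}) {X Y : FintypeCat.{u}} (p : P.El X Y) : ap (𝟙 P) p = p :=
  rfl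

@[simp]
theorem ap_comp {P Q R : Endoprof.{u}} (σ : P ⟶ Q) (τ : Q ⟶ R) {X Y : FintypeCat.{u}}
    (p : P.El X Y) : ap (σ ≫ τ) p = ap τ (ap σ p) :=
  rfl

theorem hom_ext {P Q : Endoprof.{u}} {σ τ : P ⟶ Q}
    (h : ∀ (X Y : FintypeCat.{u}) (p : P.El X Y), ap σ p = ap τ p) : σ = τ := by
  ext A p
  exact h A.1.unop A.2 p

/-- Constructor for natural transformations. -/
def homMk {P Q : Endoprof.{u}} (t : ∀ {X Y : FintypeCat.{u}}, P.El X Y → Q.El X Y)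
    (ht : ∀ {X X' Y Y' : FintypeCat.{u}} (f : X' ⟶ X) (g : Y ⟶ Y') (p : P.El X Y),
      t (P.act f g p) = Q.act f g (t p)) : P ⟶ Q where
  app A := ↾(fun p : P.El A.1.unop A.2 => t p)
  naturality A B k := by
    ext p
    exact ht k.1.unop k.2 p

@[simp]
theorem ap_homMk {P Q : Endoprof.{u}} (t : ∀ {X Y : FintypeCat.{u}}, P.El X Y → Q.El X Y)
    (ht : ∀ {X X' Y Y' : FintypeCat.{u}} (f : X' ⟶ X) (g : Y ⟶ Y') (p : P.El X Y),
      t (P.act f g p) = Q.act f g (t p)) {X Y : FintypeCat.{u}} (p : P.El X Y) :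
    ap (homMk t ht) p = t p :=
  rfl

/-- The functor `(W', W) ↦ P(X, W) × Q(W', Y)` of which the tensor of `P` and `Q` at `(X, Y)`
is the coend. -/
def tensorDiagram (P Q : Endoprof.{u}) (X Y : FintypeCat.{u}) :
    FintypeCat.{u}ᵒᵖ ⥤ FintypeCat.{u} ⥤ Type u where
  obj W' :=
    { obj W := P.El X W × Q.El W'.unop Y
      map g := ↾(fun s => (P.act (𝟙 X) g s.1, s.2))
      map_id W := by ext s <;> simp
      map_comp g g' := by ext s <;> simp }
  map f := { app W := ↾(fun s => (s.1, Q.act f.unop (𝟙 Y) s.2)) }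
  map_id W := by ext W s <;> simp
  map_comp g g' := by ext W s <;> simp

instance hasCoend_tensorDiagram (P Q : Endoprof.{u}) (X Y : FintypeCat.{u}) :
    HasCoend (tensorDiagram P Q X Y) := by
  refine (Types.hasColimit_iff_small_colimitType _).mpr ?_
  let D := (multispanIndexCoend (tensorDiagram P Q X Y)).multispan
  let S : Type u := Σ n : FintypeCat.Skeleton.{u},
    P.El X (FintypeCat.Skeleton.incl.obj n) × Q.El (FintypeCat.Skeleton.incl.obj n) Y
  let φ : S → D.ColimitType := fun s =>
    D.ιColimitType (WalkingMultispan.right (FintypeCat.Skeleton.incl.obj s.1)) s.2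
  have key : ∀ {W W' : FintypeCat.{u}} (h : W ⟶ W') (p : P.El X W) (q : Q.El W' Y),
      D.ιColimitType (WalkingMultispan.right W) (p, Q.act h (𝟙 Y) q) =
        D.ιColimitType (WalkingMultispan.right W') (P.act (𝟙 X) h p, q) := by
    intro W W' h p q
    have h₁ := D.ιColimitType_map (WalkingMultispan.Hom.fst (Arrow.mk h)) (p, q)
    have h₂ := D.ιColimitType_map (WalkingMultispan.Hom.snd (Arrow.mk h)) (p, q)
    exact h₁.trans h₂.symm
  refine small_of_surjective (f := φ) ?_
  intro c
  obtain ⟨j, s, rfl⟩ := D.ιColimitType_jointly_surjective c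
  obtain ⟨W, p, q, hW⟩ : ∃ (W : FintypeCat.{u}) (p : P.El X W) (q : Q.El W Y),
      D.ιColimitType j s = D.ιColimitType (WalkingMultispan.right W) (p, q) := by
    cases j with
    | left a => exact ⟨_, _, _, (D.ιColimitType_map (WalkingMultispan.Hom.fst a) s).symm⟩
    | right W => exact ⟨W, s.1, s.2, rfl⟩
  rw [hW]
  let e := FintypeCat.Skeleton.incl.objObjPreimageIso W
  refine ⟨⟨FintypeCat.Skeleton.incl.objPreimage W, P.act (𝟙 X) e.inv p, Q.act e.hom (𝟙 Y) q⟩, ?_⟩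
  refine (key e.hom _ q).trans ?_
  simp

/-- The map of diagrams induced by `f : X' ⟶ X` and `g : Y ⟶ Y'`. -/
def tensorDiagramMap (P Q : Endoprof.{u}) {X X' Y Y' : FintypeCat.{u}} (f : X' ⟶ X)
    (g : Y ⟶ Y') : tensorDiagram P Q X Y ⟶ tensorDiagram P Q X' Y' where
  app W' :=
    { app W := ↾(fun s : P.El X W × Q.El W'.unop Y =>
        ((P.act f (𝟙 W) s.1, Q.act (𝟙 W'.unop) g s.2) : P.El X' W × Q.El W'.unop Y'))
      naturality := fun W₁ W₂ h => by
        ext s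
        refine Prod.ext (?_ : P.act f (𝟙 W₂) (P.act (𝟙 X) h s.1) =
          P.act (𝟙 X') h (P.act f (𝟙 W₁) s.1)) rfl
        simp }
  naturality W₁ W₂ h := by
    ext W s
    refine Prod.ext rfl (?_ : Q.act (𝟙 W₂.unop) g (Q.act h.unop (𝟙 Y) s.2) =
      Q.act h.unop (𝟙 Y') (Q.act (𝟙 W₁.unop) g s.2))
    simp

/-- Bénabou's tensor of endoprofunctors: `(P ⊗ Q)(X, Y) = ∫^W P(X, W) × Q(W, Y)`. -/
noncomputable def tensor (P Q : Endoprof.{u}) : Endoprof.{u} where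
  obj A := coend (tensorDiagram P Q A.1.unop A.2)
  map k := coend.map (tensorDiagramMap P Q k.1.unop k.2)
  map_id A := by
    refine Eq.trans (congrArg (fun k => coend.map k) ?_)
      (coend.map_id (F := tensorDiagram P Q A.1.unop A.2))
    ext W' W s
    exact Prod.ext (P.act_id s.1) (Q.act_id s.2)
  map_comp {A B C} k l := by
    refine Eq.trans (congrArg (fun k => coend.map k) ?_) (coend.map_comp _ _).symm
    ext W' W s
    refine Prod.ext (?_ : P.act (l.1.unop ≫ k.1.unop) (𝟙 W) s.1 =
        P.act l.1.unop (𝟙 W) (P.act k.1.unop (𝟙 W) s.1))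
      (?_ : Q.act (𝟙 W'.unop) (k.2 ≫ l.2) s.2 =
        Q.act (𝟙 W'.unop) l.2 (Q.act (𝟙 W'.unop) k.2 s.2)) <;> simp

/-- The coend injection `ι_W : P(X, W) × Q(W, Y) → ∫^W P(X, W) × Q(W, Y)`. -/
noncomputable def inj (P Q : Endoprof.{u}) {X W Y : FintypeCat.{u}} (p : P.El X W)
    (q : Q.El W Y) : (tensor P Q).El X Y :=
  coend.ι (tensorDiagram P Q X Y) W (p, q)

theorem inj_act (P Q : Endoprof.{u}) {X W W' Y : FintypeCat.{u}} (h : W ⟶ W') (p : P.El X W)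
    (q : Q.El W' Y) : inj P Q p (Q.act h (𝟙 Y) q) = inj P Q (P.act (𝟙 X) h p) q :=
  congrArg (fun k : ((tensorDiagram P Q X Y).obj (op W')).obj W ⟶
    coend (tensorDiagram P Q X Y) => k (p, q)) (coend.condition (tensorDiagram P Q X Y) h)

theorem inj_surjective (P Q : Endoprof.{u}) {X Y : FintypeCat.{u}} (t : (tensor P Q).El X Y) :
    ∃ (W : FintypeCat.{u}) (p : P.El X W) (q : Q.El W Y), t = inj P Q p q := by
  obtain ⟨j, s, rfl⟩ := Types.jointly_surjective_of_isColimit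
    (colimit.isColimit (multispanIndexCoend (tensorDiagram P Q X Y)).multispan) t
  cases j with
  | left a =>
    refine ⟨_, _, _, (congrArg (fun k => k s) (colimit.w
      (multispanIndexCoend (tensorDiagram P Q X Y)).multispan
      (WalkingMultispan.Hom.fst a))).symm⟩
  | right W => exact ⟨W, s.1, s.2, rfl⟩

/-- The map out of the coend `∫^W P(X, W) × Q(W, Y)` given by its universal property. -/
noncomputable def lift (P Q : Endoprof.{u}) {X Y : FintypeCat.{u}} {T : Type u}
    (f : ∀ W : FintypeCat.{u}, P.El X W → Q.El W Y → T)
    (hf : ∀ (W W' : FintypeCat.{u}) (h : W ⟶ W') (p : P.El X W) (q : Q.El W' Y),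
      f W p (Q.act h (𝟙 Y) q) = f W' (P.act (𝟙 X) h p) q) (t : (tensor P Q).El X Y) : T :=
  coend.desc (F := tensorDiagram P Q X Y) (X := T)
    (fun W => ↾(fun s : P.El X W × Q.El W Y => f W s.1 s.2))
    (fun _ _ h => by ext s; exact hf _ _ h s.1 s.2) t

@[simp]
theorem lift_inj (P Q : Endoprof.{u}) {X Y : FintypeCat.{u}} {T : Type u}
    (f : ∀ W : FintypeCat.{u}, P.El X W → Q.El W Y → T)
    (hf : ∀ (W W' : FintypeCat.{u}) (h : W ⟶ W') (p : P.El X W) (q : Q.El W' Y),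
      f W p (Q.act h (𝟙 Y) q) = f W' (P.act (𝟙 X) h p) q) {W : FintypeCat.{u}} (p : P.El X W)
    (q : Q.El W Y) : lift P Q f hf (inj P Q p q) = f W p q :=
  congrArg (fun k : ((tensorDiagram P Q X Y).obj (op W)).obj W ⟶ T => k (p, q))
    (coend.ι_desc (F := tensorDiagram P Q X Y) (X := T)
      (fun W => ↾(fun s : P.El X W × Q.El W Y => f W s.1 s.2))
      (fun _ _ h => by ext s; exact hf _ _ h s.1 s.2) W)

theorem act_inj (P Q : Endoprof.{u}) {X X' W Y Y' : FintypeCat.{u}} (f : X' ⟶ X) (g : Y ⟶ Y')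
    (p : P.El X W) (q : Q.El W Y) :
    (tensor P Q).act f g (inj P Q p q) = inj P Q (P.act f (𝟙 W) p) (Q.act (𝟙 W) g q) :=
  congrArg (fun k : ((tensorDiagram P Q X Y).obj (op W)).obj W ⟶
    coend (tensorDiagram P Q X' Y') => k (p, q)) (coend.ι_map (tensorDiagramMap P Q f g) W)

end Endoprof

/-! ### Strong endoprofunctors -/

/-- A (right) strong endoprofunctor on finite sets. -/
structure StrongProf : Type (u + 1) where
  /-- the underlying endoprofunctor -/
  prof : Endoprof.{u}
  /-- the strength -/
  str {X Y : FintypeCat.{u}} (Z : FintypeCat.{u}) : prof.El X Y → prof.El (X ⊗ Z) (Y ⊗ Z)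
  /-- the strength is natural in `X` and `Y` -/
  str_natural {X X' Y Y' : FintypeCat.{u}} (Z : FintypeCat.{u}) (f : X' ⟶ X) (g : Y ⟶ Y')
    (p : prof.El X Y) : str Z (prof.act f g p) = prof.act (f ▷ Z) (g ▷ Z) (str Z p)
  /-- the strength is dinatural in `Z` -/
  str_dinatural {X Y Z Z' : FintypeCat.{u}} (h : Z ⟶ Z') (p : prof.El X Y) :
    prof.act (𝟙 (X ⊗ Z)) (Y ◁ h) (str Z p) = prof.act (X ◁ h) (𝟙 (Y ⊗ Z')) (str Z' p)
  /-- `P(id, π₁) ∘ str_{X, Y, 1} = P(π₁, id)` -/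
  str_one {X Y : FintypeCat.{u}} (p : prof.El X Y) :
    prof.act (𝟙 (X ⊗ 𝟙_ FintypeCat)) (SemiCartesianMonoidalCategory.fst Y (𝟙_ FintypeCat))
        (str (𝟙_ FintypeCat) p) =
      prof.act (SemiCartesianMonoidalCategory.fst X (𝟙_ FintypeCat)) (𝟙 Y) p
  /-- compatibility of the strength with the associativity of the product -/
  str_assoc {X Y : FintypeCat.{u}} (V W : FintypeCat.{u}) (p : prof.El X Y) :
    str W (str V p) = prof.act (α_ X V W).hom (α_ Y V W).inv (str (V ⊗ W) p)

namespace StrongProf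

/-- A strong natural transformation. -/
@[ext]
structure Hom (P Q : StrongProf.{u}) : Type (u + 1) where
  /-- the underlying natural transformation -/
  nat : P.prof ⟶ Q.prof
  /-- compatibility with the strengths -/
  strong {X Y : FintypeCat.{u}} (Z : FintypeCat.{u}) (p : P.prof.El X Y) :
    Endoprof.ap nat (P.str Z p) = Q.str Z (Endoprof.ap nat p)

/-- The category of strong endoprofunctors and strong natural transformations. -/
instance : Category StrongProf.{u} where
  Hom := Hom
  id P := { nat := 𝟙 P.prof, strong := fun _ _ => rfl }
  comp σ τ :=
    { nat := σ.nat ≫ τ.nat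
      strong := fun Z p => by rw [Endoprof.ap_comp, Endoprof.ap_comp, σ.strong, τ.strong] }

/-- The component `τ_{X, Y}` of a strong natural transformation. -/
def app {P Q : StrongProf.{u}} (τ : P ⟶ Q) {X Y : FintypeCat.{u}} (p : P.prof.El X Y) :
    Q.prof.El X Y :=
  Endoprof.ap (Hom.nat τ) p

theorem hom_ext {P Q : StrongProf.{u}} {σ τ : P ⟶ Q}
    (h : ∀ {X Y : FintypeCat.{u}} (p : P.prof.El X Y), app σ p = app τ p) : σ = τ :=
  Hom.ext (Endoprof.hom_ext fun _ _ p => h p)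

@[simp]
theorem app_act {P Q : StrongProf.{u}} (τ : P ⟶ Q) {X X' Y Y' : FintypeCat.{u}} (f : X' ⟶ X)
    (g : Y ⟶ Y') (p : P.prof.El X Y) : app τ (P.prof.act f g p) = Q.prof.act f g (app τ p) :=
  Endoprof.ap_act _ f g p

theorem app_str {P Q : StrongProf.{u}} (τ : P ⟶ Q) {X Y : FintypeCat.{u}} (Z : FintypeCat.{u})
    (p : P.prof.El X Y) : app τ (P.str Z p) = Q.str Z (app τ p) :=
  Hom.strong τ Z p

@[simp]
theorem app_id (P : StrongProf.{u}) {X Y : FintypeCat.{u}} (p : P.prof.El X Y) :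
    app (𝟙 P) p = p :=
  rfl

@[simp]
theorem app_comp {P Q R : StrongProf.{u}} (σ : P ⟶ Q) (τ : Q ⟶ R) {X Y : FintypeCat.{u}}
    (p : P.prof.El X Y) : app (σ ≫ τ) p = app τ (app σ p) :=
  rfl

/-- Constructor for strong natural transformations. -/
def homMk {P Q : StrongProf.{u}}
    (t : ∀ {X Y : FintypeCat.{u}}, P.prof.El X Y → Q.prof.El X Y)
    (ht : ∀ {X X' Y Y' : FintypeCat.{u}} (f : X' ⟶ X) (g : Y ⟶ Y') (p : P.prof.El X Y),
      t (P.prof.act f g p) = Q.prof.act f g (t p))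
    (hs : ∀ {X Y : FintypeCat.{u}} (Z : FintypeCat.{u}) (p : P.prof.El X Y),
      t (P.str Z p) = Q.str Z (t p)) : P ⟶ Q where
  nat := Endoprof.homMk t ht
  strong := hs

@[simp]
theorem app_homMk {P Q : StrongProf.{u}}
    (t : ∀ {X Y : FintypeCat.{u}}, P.prof.El X Y → Q.prof.El X Y)
    (ht : ∀ {X X' Y Y' : FintypeCat.{u}} (f : X' ⟶ X) (g : Y ⟶ Y') (p : P.prof.El X Y),
      t (P.prof.act f g p) = Q.prof.act f g (t p))
    (hs : ∀ {X Y : FintypeCat.{u}} (Z : FintypeCat.{u}) (p : P.prof.El X Y),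
      t (P.str Z p) = Q.str Z (t p)) {X Y : FintypeCat.{u}} (p : P.prof.El X Y) :
    app (homMk t ht hs) p = t p :=
  rfl

/-! ### The monoidal structure on strong endoprofunctors -/

open Endoprof

/-- The strength of `P ⊗ Q`: the unique map with
`str ∘ ι_W = ι_{W × Z} ∘ (str^P × str^Q)`. -/
noncomputable def tensorStr (P Q : StrongProf.{u}) {X Y : FintypeCat.{u}} (Z : FintypeCat.{u}) :
    (Endoprof.tensor P.prof Q.prof).El X Y →
      (Endoprof.tensor P.prof Q.prof).El (X ⊗ Z) (Y ⊗ Z) :=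
  lift P.prof Q.prof (fun _ p q => inj P.prof Q.prof (P.str Z p) (Q.str Z q))
    (fun _ _ h p q => by
      rw [Q.str_natural, P.str_natural, MonoidalCategory.id_whiskerRight,
        MonoidalCategory.id_whiskerRight, inj_act])

theorem tensorStr_inj (P Q : StrongProf.{u}) {X W Y : FintypeCat.{u}} (Z : FintypeCat.{u})
    (p : P.prof.El X W) (q : Q.prof.El W Y) :
    tensorStr P Q Z (inj P.prof Q.prof p q) = inj P.prof Q.prof (P.str Z p) (Q.str Z q) := by
  simp only [tensorStr, lift_inj]

/-- The tensor of strong endoprofunctors. -/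
noncomputable def tensorObj (P Q : StrongProf.{u}) : StrongProf.{u} where
  prof := Endoprof.tensor P.prof Q.prof
  str Z := tensorStr P Q Z
  str_natural Z f g t := by
    obtain ⟨W, p, q, rfl⟩ := inj_surjective _ _ t
    rw [act_inj, tensorStr_inj, tensorStr_inj, act_inj, P.str_natural, Q.str_natural,
      MonoidalCategory.id_whiskerRight]
  str_dinatural {X Y Z Z'} h t := by
    obtain ⟨W, p, q, rfl⟩ := inj_surjective _ _ t
    rw [tensorStr_inj, tensorStr_inj, act_inj, act_inj, Q.str_dinatural, act_id, inj_act, P.str_dinatural,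
      act_id]
  str_one {X Y} t := by
    obtain ⟨W, p, q, rfl⟩ := inj_surjective _ _ t
    rw [tensorStr_inj, act_inj, act_inj, Q.str_one, act_id, act_id, inj_act, P.str_one]
  str_assoc {X Y} V W t := by
    obtain ⟨U, p, q, rfl⟩ := inj_surjective _ _ t
    have e := inj_act P.prof Q.prof (α_ U V W).hom
      (P.prof.act (α_ X V W).hom (α_ U V W).inv (P.str (V ⊗ W) p))
      (Q.prof.act (𝟙 _) (α_ Y V W).inv (Q.str (V ⊗ W) q))
    rw [tensorStr_inj, tensorStr_inj, tensorStr_inj, act_inj, P.str_assoc, Q.str_assoc]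
    simpa using e

/-- The profunctor `Hom(X, Y)`. -/
def homProf : Endoprof.{u} where
  obj A := A.1.unop ⟶ A.2
  map k := ↾(fun f => k.1.unop ≫ f ≫ k.2)

/-- The tensor unit: the profunctor `Hom` with the strength `f ↦ f × id`. -/
def tensorUnit : StrongProf.{u} where
  prof := homProf
  str {X Y} Z f := (show X ⟶ Y from f) ▷ Z
  str_natural _ _ _ _ := rfl
  str_dinatural _ _ := rfl
  str_one _ := rfl
  str_assoc _ _ _ := rfl

/-- A map of finite sets, as an element of the tensor unit. -/
def homEl {X Y : FintypeCat.{u}} (f : X ⟶ Y) : tensorUnit.{u}.prof.El X Y := f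

/-- An element of the tensor unit, as a map of finite sets. -/
def elHom {X Y : FintypeCat.{u}} (f : tensorUnit.{u}.prof.El X Y) : X ⟶ Y := f

@[simp]
theorem elHom_homEl {X Y : FintypeCat.{u}} (f : X ⟶ Y) : elHom (homEl f) = f := rfl

@[simp]
theorem homEl_elHom {X Y : FintypeCat.{u}} (f : tensorUnit.{u}.prof.El X Y) :
    homEl (elHom f) = f := rfl

@[simp]
theorem elHom_act {X X' Y Y' : FintypeCat.{u}} (f : X' ⟶ X) (g : Y ⟶ Y')
    (k : tensorUnit.{u}.prof.El X Y) :
    elHom (tensorUnit.prof.act f g k) = f ≫ elHom k ≫ g := rfl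

theorem act_homEl {X X' Y Y' : FintypeCat.{u}} (f : X' ⟶ X) (g : Y ⟶ Y') (k : X ⟶ Y) :
    tensorUnit.prof.act f g (homEl k) = homEl (f ≫ k ≫ g) := rfl

@[simp]
theorem elHom_str {X Y : FintypeCat.{u}} (Z : FintypeCat.{u})
    (k : tensorUnit.{u}.prof.El X Y) : elHom (tensorUnit.str Z k) = elHom k ▷ Z := rfl

theorem str_homEl {X Y : FintypeCat.{u}} (Z : FintypeCat.{u}) (k : X ⟶ Y) :
    tensorUnit.str Z (homEl k) = homEl (k ▷ Z) := rfl

/-- The element of `(P ⊗ Q)(X, Y)` given by `p ∈ P(X, W)` and `q ∈ Q(W, Y)`. -/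
noncomputable def pair {P Q : StrongProf.{u}} {X W Y : FintypeCat.{u}} (p : P.prof.El X W)
    (q : Q.prof.El W Y) : (tensorObj P Q).prof.El X Y :=
  inj P.prof Q.prof p q

theorem pair_act {P Q : StrongProf.{u}} {X W W' Y : FintypeCat.{u}} (h : W ⟶ W')
    (p : P.prof.El X W) (q : Q.prof.El W' Y) :
    pair p (Q.prof.act h (𝟙 Y) q) = pair (P.prof.act (𝟙 X) h p) q :=
  inj_act P.prof Q.prof h p q

theorem pair_surjective {P Q : StrongProf.{u}} {X Y : FintypeCat.{u}}
    (t : (tensorObj P Q).prof.El X Y) :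
    ∃ (W : FintypeCat.{u}) (p : P.prof.El X W) (q : Q.prof.El W Y), t = pair p q :=
  inj_surjective P.prof Q.prof t

theorem act_pair {P Q : StrongProf.{u}} {X X' W Y Y' : FintypeCat.{u}} (f : X' ⟶ X)
    (g : Y ⟶ Y') (p : P.prof.El X W) (q : Q.prof.El W Y) :
    (tensorObj P Q).prof.act f g (pair p q) =
      pair (P.prof.act f (𝟙 W) p) (Q.prof.act (𝟙 W) g q) :=
  act_inj P.prof Q.prof f g p q

theorem str_pair {P Q : StrongProf.{u}} {X W Y : FintypeCat.{u}} (Z : FintypeCat.{u})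
    (p : P.prof.El X W) (q : Q.prof.El W Y) :
    (tensorObj P Q).str Z (pair p q) = pair (P.str Z p) (Q.str Z q) :=
  tensorStr_inj P Q Z p q

/-- The map out of `(P ⊗ Q)(X, Y)` given by the universal property of coends. -/
noncomputable def pairLift {P Q : StrongProf.{u}} {X Y : FintypeCat.{u}} {T : Type u}
    (f : ∀ W : FintypeCat.{u}, P.prof.El X W → Q.prof.El W Y → T)
    (hf : ∀ (W W' : FintypeCat.{u}) (h : W ⟶ W') (p : P.prof.El X W) (q : Q.prof.El W' Y),
      f W p (Q.prof.act h (𝟙 Y) q) = f W' (P.prof.act (𝟙 X) h p) q)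
    (t : (tensorObj P Q).prof.El X Y) : T :=
  lift P.prof Q.prof f hf t

@[simp]
theorem pairLift_pair {P Q : StrongProf.{u}} {X Y : FintypeCat.{u}} {T : Type u}
    (f : ∀ W : FintypeCat.{u}, P.prof.El X W → Q.prof.El W Y → T)
    (hf : ∀ (W W' : FintypeCat.{u}) (h : W ⟶ W') (p : P.prof.El X W) (q : Q.prof.El W' Y),
      f W p (Q.prof.act h (𝟙 Y) q) = f W' (P.prof.act (𝟙 X) h p) q) {W : FintypeCat.{u}}
    (p : P.prof.El X W) (q : Q.prof.El W Y) : pairLift f hf (pair p q) = f W p q :=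
  lift_inj P.prof Q.prof f hf p q

theorem tensorObj_ext {P Q R : StrongProf.{u}} {σ τ : tensorObj P Q ⟶ R}
    (h : ∀ {X W Y : FintypeCat.{u}} (p : P.prof.El X W) (q : Q.prof.El W Y),
      app σ (pair p q) = app τ (pair p q)) : σ = τ :=
  hom_ext fun t => by
    obtain ⟨W, p, q, rfl⟩ := pair_surjective t
    exact h p q

/-- The map out of a tensor given by the universal property of coends. -/
noncomputable def tensorDesc {P Q R : StrongProf.{u}}
    (t : ∀ X W Y : FintypeCat.{u}, P.prof.El X W → Q.prof.El W Y → R.prof.El X Y)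
    (hw : ∀ (X W W' Y : FintypeCat.{u}) (h : W ⟶ W') (p : P.prof.El X W) (q : Q.prof.El W' Y),
      t X W Y p (Q.prof.act h (𝟙 Y) q) = t X W' Y (P.prof.act (𝟙 X) h p) q)
    (ht : ∀ (X X' W Y Y' : FintypeCat.{u}) (f : X' ⟶ X) (g : Y ⟶ Y') (p : P.prof.El X W)
      (q : Q.prof.El W Y),
      t X' W Y' (P.prof.act f (𝟙 W) p) (Q.prof.act (𝟙 W) g q) =
        R.prof.act f g (t X W Y p q))
    (hs : ∀ (X W Y : FintypeCat.{u}) (Z : FintypeCat.{u}) (p : P.prof.El X W)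
      (q : Q.prof.El W Y), t _ _ _ (P.str Z p) (Q.str Z q) = R.str Z (t X W Y p q)) :
    tensorObj P Q ⟶ R :=
  homMk (fun {X Y} => pairLift (fun W => t X W Y) fun _ _ h p q => hw _ _ _ _ h p q)
    (fun f g s => by
      obtain ⟨W, p, q, rfl⟩ := pair_surjective s
      rw [act_pair, pairLift_pair, pairLift_pair]; exact ht _ _ _ _ _ f g p q)
    (fun Z s => by
      obtain ⟨W, p, q, rfl⟩ := pair_surjective s
      rw [str_pair, pairLift_pair, pairLift_pair]; exact hs _ _ _ Z p q)

@[simp]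
theorem app_tensorDesc {P Q R : StrongProf.{u}}
    (t : ∀ X W Y : FintypeCat.{u}, P.prof.El X W → Q.prof.El W Y → R.prof.El X Y)
    (hw : ∀ (X W W' Y : FintypeCat.{u}) (h : W ⟶ W') (p : P.prof.El X W) (q : Q.prof.El W' Y),
      t X W Y p (Q.prof.act h (𝟙 Y) q) = t X W' Y (P.prof.act (𝟙 X) h p) q)
    (ht : ∀ (X X' W Y Y' : FintypeCat.{u}) (f : X' ⟶ X) (g : Y ⟶ Y') (p : P.prof.El X W)
      (q : Q.prof.El W Y),
      t X' W Y' (P.prof.act f (𝟙 W) p) (Q.prof.act (𝟙 W) g q) =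
        R.prof.act f g (t X W Y p q))
    (hs : ∀ (X W Y : FintypeCat.{u}) (Z : FintypeCat.{u}) (p : P.prof.El X W)
      (q : Q.prof.El W Y), t _ _ _ (P.str Z p) (Q.str Z q) = R.str Z (t X W Y p q))
    {X W Y : FintypeCat.{u}} (p : P.prof.El X W) (q : Q.prof.El W Y) :
    app (tensorDesc (R := R) t hw ht hs) (pair p q) = t X W Y p q :=
  pairLift_pair (fun W => t X W Y) (fun _ _ h p q => hw _ _ _ _ h p q) p q

/-- The tensor `σ ⊗ τ` of strong natural transformations. -/
noncomputable def tensorMap {P P' Q Q' : StrongProf.{u}} (σ : P ⟶ P') (τ : Q ⟶ Q') :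
    tensorObj P Q ⟶ tensorObj P' Q' :=
  tensorDesc (fun _ _ _ p q => pair (app σ p) (app τ q))
    (fun _ _ _ _ h p q => by rw [app_act, app_act, pair_act])
    (fun _ _ _ _ _ f g p q => by rw [app_act, app_act, act_pair])
    (fun _ _ _ Z p q => by rw [app_str, app_str, str_pair])

@[simp]
theorem app_tensorMap {P P' Q Q' : StrongProf.{u}} (σ : P ⟶ P') (τ : Q ⟶ Q')
    {X W Y : FintypeCat.{u}} (p : P.prof.El X W) (q : Q.prof.El W Y) :
    app (tensorMap σ τ) (pair p q) = pair (app σ p) (app τ q) := by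
  simp only [tensorMap, app_tensorDesc]

/-- The map `(P ⊗ Q) ⊗ R ⟶ P ⊗ (Q ⊗ R)`, `((p, q), r) ↦ (p, (q, r))`. -/
noncomputable def assocHom (P Q R : StrongProf.{u}) :
    tensorObj (tensorObj P Q) R ⟶ tensorObj P (tensorObj Q R) :=
  tensorDesc
    (fun _ _ _ s r => pairLift
      (fun _ p q => pair p (pair q r))
      (fun _ _ h p q => by rw [← pair_act, act_pair, act_id]) s)
    (fun _ _ _ _ h s r => by
      obtain ⟨W, p, q, rfl⟩ := pair_surjective s
      rw [act_pair, pairLift_pair, pairLift_pair, pair_act, act_id])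
    (fun _ _ _ _ _ f g s r => by
      obtain ⟨W, p, q, rfl⟩ := pair_surjective s
      rw [act_pair, pairLift_pair, pairLift_pair, act_id, act_pair, act_pair,
        act_id])
    (fun _ _ _ Z s r => by
      obtain ⟨W, p, q, rfl⟩ := pair_surjective s
      rw [str_pair, pairLift_pair, pairLift_pair, str_pair, str_pair])

@[simp]
theorem app_assocHom (P Q R : StrongProf.{u}) {X V W Y : FintypeCat.{u}} (p : P.prof.El X V)
    (q : Q.prof.El V W) (r : R.prof.El W Y) :
    app (assocHom P Q R) (pair (pair p q) r) =
      pair p (pair q r) := by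
  simp only [assocHom, app_tensorDesc, pairLift_pair]

/-- The map `P ⊗ (Q ⊗ R) ⟶ (P ⊗ Q) ⊗ R`, `(p, (q, r)) ↦ ((p, q), r)`. -/
noncomputable def assocInv (P Q R : StrongProf.{u}) :
    tensorObj P (tensorObj Q R) ⟶ tensorObj (tensorObj P Q) R :=
  tensorDesc
    (fun _ _ _ p s => pairLift
      (fun _ q r => pair (pair p q) r)
      (fun _ _ h q r => by rw [pair_act, act_pair, act_id]) s)
    (fun _ _ _ _ h p s => by
      obtain ⟨W, q, r, rfl⟩ := pair_surjective s
      rw [act_pair, pairLift_pair, pairLift_pair, act_id, pair_act])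
    (fun _ _ _ _ _ f g p s => by
      obtain ⟨W, q, r, rfl⟩ := pair_surjective s
      rw [act_pair, pairLift_pair, pairLift_pair, act_id, act_pair, act_pair,
        act_id])
    (fun _ _ _ Z p s => by
      obtain ⟨W, q, r, rfl⟩ := pair_surjective s
      rw [str_pair, pairLift_pair, pairLift_pair, str_pair, str_pair])

@[simp]
theorem app_assocInv (P Q R : StrongProf.{u}) {X V W Y : FintypeCat.{u}} (p : P.prof.El X V)
    (q : Q.prof.El V W) (r : R.prof.El W Y) :
    app (assocInv P Q R) (pair p (pair q r)) =
      pair (pair p q) r := by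
  simp only [assocInv, app_tensorDesc, pairLift_pair]

theorem tensorObj_ext_left {P Q R S : StrongProf.{u}} {σ τ : tensorObj (tensorObj P Q) R ⟶ S}
    (h : ∀ {X V W Y : FintypeCat.{u}} (p : P.prof.El X V) (q : Q.prof.El V W)
      (r : R.prof.El W Y),
      app σ (pair (pair p q) r) =
        app τ (pair (pair p q) r)) : σ = τ :=
  tensorObj_ext fun s r => by
    obtain ⟨W, p, q, rfl⟩ := pair_surjective s
    exact h p q r

theorem tensorObj_ext_right {P Q R S : StrongProf.{u}} {σ τ : tensorObj P (tensorObj Q R) ⟶ S}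
    (h : ∀ {X V W Y : FintypeCat.{u}} (p : P.prof.El X V) (q : Q.prof.El V W)
      (r : R.prof.El W Y),
      app σ (pair p (pair q r)) =
        app τ (pair p (pair q r))) : σ = τ :=
  tensorObj_ext fun p s => by
    obtain ⟨W, q, r, rfl⟩ := pair_surjective s
    exact h p q r

/-- The map `Hom ⊗ P ⟶ P`, `(f, p) ↦ P(f, id)(p)`. -/
noncomputable def leftUnitorHom (P : StrongProf.{u}) : tensorObj tensorUnit P ⟶ P :=
  tensorDesc (fun _ _ Y f p => P.prof.act (elHom f) (𝟙 Y) p)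
    (fun _ _ _ _ h f p => by simp)
    (fun _ _ _ _ _ f g k p => by simp)
    (fun _ _ _ Z f p => by rw [elHom_str, P.str_natural, MonoidalCategory.id_whiskerRight])

/-- The map `P ⊗ Hom ⟶ P`, `(p, f) ↦ P(id, f)(p)`. -/
noncomputable def rightUnitorHom (P : StrongProf.{u}) : tensorObj P tensorUnit ⟶ P :=
  tensorDesc (fun X _ _ p f => P.prof.act (𝟙 X) (elHom f) p)
    (fun _ _ _ _ h p f => by simp)
    (fun _ _ _ _ _ f g p k => by simp)
    (fun _ _ _ Z p f => by rw [elHom_str, P.str_natural, MonoidalCategory.id_whiskerRight])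

@[simp]
theorem app_leftUnitorHom (P : StrongProf.{u}) {X W Y : FintypeCat.{u}}
    (f : tensorUnit.prof.El X W) (p : P.prof.El W Y) :
    app (leftUnitorHom P) (pair f p) = P.prof.act (elHom f) (𝟙 Y) p := by
  simp only [leftUnitorHom, app_tensorDesc]

@[simp]
theorem app_rightUnitorHom (P : StrongProf.{u}) {X W Y : FintypeCat.{u}} (p : P.prof.El X W)
    (f : tensorUnit.prof.El W Y) :
    app (rightUnitorHom P) (pair p f) = P.prof.act (𝟙 X) (elHom f) p := by
  simp only [rightUnitorHom, app_tensorDesc]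

/-- The map `P ⟶ Hom ⊗ P`, `p ↦ (id, p)`. -/
noncomputable def leftUnitorInv (P : StrongProf.{u}) : P ⟶ tensorObj tensorUnit P :=
  homMk (fun {X Y} p => pair (homEl (𝟙 X)) p)
    (fun {X X' Y Y'} f g p => by
      have e := pair_act (P := tensorUnit) (Q := P) f (homEl (𝟙 X')) (P.prof.act (𝟙 X) g p)
      simpa [act_pair, act_homEl] using e)
    (fun Z p => by simp [str_pair, str_homEl])

/-- The map `P ⟶ P ⊗ Hom`, `p ↦ (p, id)`. -/
noncomputable def rightUnitorInv (P : StrongProf.{u}) : P ⟶ tensorObj P tensorUnit :=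
  homMk (fun {X Y} p => pair p (homEl (𝟙 Y)))
    (fun {X X' Y Y'} f g p => by
      have e := pair_act (P := P) (Q := tensorUnit) g (P.prof.act f (𝟙 Y) p) (homEl (𝟙 Y'))
      simpa [act_pair, act_homEl] using e.symm)
    (fun Z p => by simp [str_pair, str_homEl])

@[simp]
theorem app_leftUnitorInv (P : StrongProf.{u}) {X Y : FintypeCat.{u}} (p : P.prof.El X Y) :
    app (leftUnitorInv P) p = pair (homEl (𝟙 X)) p :=
  rfl

@[simp]
theorem app_rightUnitorInv (P : StrongProf.{u}) {X Y : FintypeCat.{u}} (p : P.prof.El X Y) :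
    app (rightUnitorInv P) p = pair p (homEl (𝟙 Y)) :=
  rfl

noncomputable instance : MonoidalCategoryStruct StrongProf.{u} where
  tensorObj := tensorObj
  tensorHom := tensorMap
  whiskerLeft P _ _ τ := tensorMap (𝟙 P) τ
  whiskerRight σ Q := tensorMap σ (𝟙 Q)
  tensorUnit := tensorUnit
  associator P Q R :=
    { hom := assocHom P Q R
      inv := assocInv P Q R
      hom_inv_id := tensorObj_ext_left fun p q r => by simp
      inv_hom_id := tensorObj_ext_right fun p q r => by simp }
  leftUnitor P :=
    { hom := leftUnitorHom P
      inv := leftUnitorInv P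
      hom_inv_id := tensorObj_ext fun {X W Y} f p => by
        have e := pair_act (P := tensorUnit) (Q := P) (elHom f) (homEl (𝟙 X)) p
        rw [act_homEl] at e
        rw [app_comp, app_leftUnitorHom, app_leftUnitorInv, e]
        simp
      inv_hom_id := hom_ext fun p => by simp }
  rightUnitor P :=
    { hom := rightUnitorHom P
      inv := rightUnitorInv P
      hom_inv_id := tensorObj_ext fun {X W Y} p f => by
        have e := pair_act (P := P) (Q := tensorUnit) (elHom f) p (homEl (𝟙 Y))
        rw [act_homEl] at e
        rw [app_comp, app_rightUnitorHom, app_rightUnitorInv, ← e]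
        simp
      inv_hom_id := hom_ext fun p => by simp }

/-- The monoidal category of strong endoprofunctors with Bénabou's tensor. -/
noncomputable instance : MonoidalCategory StrongProf.{u} :=
  MonoidalCategory.ofTensorHom
    (id_tensorHom_id := fun P Q => tensorObj_ext fun p q => app_tensorMap (𝟙 P) (𝟙 Q) p q)
    (tensorHom_comp_tensorHom := fun σ τ σ' τ' => tensorObj_ext fun p q => by
      change app (tensorMap σ τ ≫ tensorMap σ' τ') _ = app (tensorMap (σ ≫ σ') (τ ≫ τ')) _
      simp)
    (associator_naturality := fun f g h => tensorObj_ext_left fun p q r => by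
      change app (tensorMap (tensorMap f g) h ≫ assocHom _ _ _) _ =
        app (assocHom _ _ _ ≫ tensorMap f (tensorMap g h)) _
      simp)
    (leftUnitor_naturality := fun {P Q} τ =>
      tensorObj_ext (P := tensorUnit) (Q := P) fun f p => by
        change app (tensorMap (𝟙 tensorUnit) τ ≫ leftUnitorHom Q) _ =
          app (leftUnitorHom P ≫ τ) _
        simp)
    (rightUnitor_naturality := fun {P Q} τ =>
      tensorObj_ext (P := P) (Q := tensorUnit) fun p f => by
        change app (tensorMap τ (𝟙 tensorUnit) ≫ rightUnitorHom Q) _ =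
          app (rightUnitorHom P ≫ τ) _
        simp)
    (pentagon := fun P Q R S => tensorObj_ext_left fun s r r' => by
      obtain ⟨V, p, q, rfl⟩ := pair_surjective s
      change app (tensorMap (assocHom P Q R) (𝟙 S) ≫ assocHom P (tensorObj Q R) S ≫
        tensorMap (𝟙 P) (assocHom Q R S)) _ =
          app (assocHom (tensorObj P Q) R S ≫ assocHom P Q (tensorObj R S)) _
      simp)
    (triangle := fun P Q =>
      tensorObj_ext_left (P := P) (Q := tensorUnit) (R := Q) fun p f q => by
        change app (assocHom P tensorUnit Q ≫ tensorMap (𝟙 P) (leftUnitorHom Q)) _ =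
          app (tensorMap (rightUnitorHom P) (𝟙 Q)) _
        simp [pair_act])
    (id_tensorHom := fun _ _ _ _ => rfl)
    (tensorHom_id := fun _ _ => rfl)

end StrongProf

/-! ### Exponentials of finite sets -/

namespace FintypeCat

/-- The exponential `X → Y` of finite sets. -/
abbrev expo (X Y : FintypeCat.{u}) : FintypeCat.{u} := FintypeCat.of (X → Y)

/-- The evaluation `ev : (X → Y) × X ⟶ Y`. -/
def ev (X Y : FintypeCat.{u}) : expo X Y ⊗ X ⟶ Y :=
  homMk (X := expo X Y ⊗ X) (Y := Y) fun p : (X → Y) × X => p.1 p.2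

/-- The currying `A ⟶ (B → C)` of a map `A × B ⟶ C`. -/
def curry {A B C : FintypeCat.{u}} (f : A ⊗ B ⟶ C) : A ⟶ expo B C :=
  homMk (X := A) (Y := expo B C) fun a b => f ((a, b) : A × B)

/-- The functoriality of the exponential, `k ↦ g ∘ k ∘ f`. -/
def expoMap {X X' Y Y' : FintypeCat.{u}} (f : X' ⟶ X) (g : Y ⟶ Y') : expo X Y ⟶ expo X' Y' :=
  homMk (X := expo X Y) (Y := expo X' Y') fun k x => g (k (f x))

/-- The map `(X → Y) ⟶ (X × Z → Y × Z)`, `k ↦ k × id`, as the currying of `(ev × id) ∘ α`. -/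
def expoStr (X Y Z : FintypeCat.{u}) : expo X Y ⟶ expo (X ⊗ Z) (Y ⊗ Z) :=
  curry ((α_ (expo X Y) X Z).inv ≫ ev X Y ▷ Z)

end FintypeCat

namespace StrongProf

open Endoprof FintypeCat

/-! ### The Cayley functor, the restriction functor and the Cayley adjunction -/

/-- The endoprofunctor `(X, Y) ↦ F(X → Y)`. -/
def cayleyProf (F : FintypeCat.{u} ⥤ Type u) : Endoprof.{u} where
  obj A := F.obj (expo A.1.unop A.2)
  map k := F.map (expoMap k.1.unop k.2)
  map_id _ := F.map_id _
  map_comp k l := F.map_comp (expoMap k.1.unop k.2) (expoMap l.1.unop l.2)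

theorem map_map (F : FintypeCat.{u} ⥤ Type u) {A B C : FintypeCat.{u}} (f : A ⟶ B) (g : B ⟶ C)
    (v : F.obj A) : F.map g (F.map f v) = F.map (f ≫ g) v := by
  simp

theorem map_square (F : FintypeCat.{u} ⥤ Type u) {A B B' C : FintypeCat.{u}} {f : A ⟶ B}
    {g : B ⟶ C} {f' : A ⟶ B'} {g' : B' ⟶ C} (e : f ≫ g = f' ≫ g') (v : F.obj A) :
    F.map g (F.map f v) = F.map g' (F.map f' v) := by
  rw [map_map, map_map, e]

/-- The strong endoprofunctor `F^!`: `F^!(X, Y) = F(X → Y)`, with the strength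
`F(X → Y) → F(X × Z → Y × Z)` given by functoriality. -/
def cayleyObj (F : FintypeCat.{u} ⥤ Type u) : StrongProf.{u} where
  prof := cayleyProf F
  str {X Y} Z := fun v : F.obj (expo X Y) => F.map (expoStr X Y Z) v
  str_natural {X X' Y Y'} Z f g v :=
    map_square F (f := expoMap f g) (g := expoStr X' Y' Z) (f' := expoStr X Y Z)
      (g' := expoMap (f ▷ Z) (g ▷ Z)) rfl v
  str_dinatural {X Y Z Z'} h v :=
    map_square F (f := expoStr X Y Z) (g := expoMap (𝟙 (X ⊗ Z)) (Y ◁ h))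
      (f' := expoStr X Y Z') (g' := expoMap (X ◁ h) (𝟙 (Y ⊗ Z'))) rfl v
  str_one {X Y} v :=
    map_map F (expoStr X Y (𝟙_ FintypeCat))
      (expoMap (𝟙 (X ⊗ 𝟙_ FintypeCat)) (SemiCartesianMonoidalCategory.fst Y (𝟙_ FintypeCat))) v
  str_assoc {X Y} V W v :=
    map_square F (f := expoStr X Y V) (g := expoStr (X ⊗ V) (Y ⊗ V) W)
      (f' := expoStr X Y (V ⊗ W)) (g' := expoMap (α_ X V W).hom (α_ Y V W).inv) rfl v

/-- The Cayley functor `(-)^! : [𝔽, 𝕊] ⥤ Prof_s`. -/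
def cayley : FinitaryDay.{u} ⥤ StrongProf.{u} where
  obj F := cayleyObj F.functor
  map τ := homMk (fun {X Y} v => τ.natTrans.app (expo X Y) v)
    (fun f g v => NatTrans.naturality_apply τ.natTrans (expoMap f g) v)
    (fun {X Y} Z v => NatTrans.naturality_apply τ.natTrans (expoStr X Y Z) v)
  map_id _ := rfl
  map_comp _ _ := rfl

/-- The functor `P_* : Z ↦ P(1, Z)`. -/
def restrictObj (P : StrongProf.{u}) : FintypeCat.{u} ⥤ Type u where
  obj Z := P.prof.El (𝟙_ FintypeCat) Z
  map g := ↾(fun p => P.prof.act (𝟙 (𝟙_ FintypeCat)) g p)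
  map_id Z := by ext p; simp
  map_comp f g := by ext p; simp

/-- The restriction functor `(-)_* : Prof_s ⥤ [𝔽, 𝕊]`. -/
def restrict : StrongProf.{u} ⥤ FinitaryDay.{u} where
  obj P := DayFunctor.mk (restrictObj P)
  map {P Q} τ := DayFunctor.Hom.mk
    { app := fun Z => ↾(fun p : P.prof.El (𝟙_ FintypeCat) Z => app τ p)
      naturality := fun _ _ g => by
        ext p
        exact app_act τ _ g p }
  map_id _ := rfl
  map_comp _ _ := rfl

/-- The unit `F(Z) ⟶ F(1 → Z)` of the Cayley adjunction. -/
def cayleyUnit (F : FinitaryDay.{u}) : F ⟶ restrict.obj (cayley.obj F) :=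
  DayFunctor.Hom.mk
    { app := fun Z => F.functor.map (curry (ρ_ Z).hom)
      naturality := fun Z Z' g => by
        have e : g ≫ curry (ρ_ Z').hom = curry (ρ_ Z).hom ≫ expoMap (𝟙 (𝟙_ FintypeCat)) g := rfl
        ext v
        refine (map_map F.functor _ _ v).trans ?_
        rw [e]
        exact (map_map F.functor _ _ v).symm }

/-- The counit `P(1, X → Y) ⟶ P(X, Y)` of the Cayley adjunction: the strength
`P(1, X → Y) → P(1 × X, (X → Y) × X)` followed by `P(λ⁻¹, ev)`. -/
def cayleyCounit (P : StrongProf.{u}) : cayley.obj (restrict.obj P) ⟶ P :=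
  homMk (fun {X Y} (p : P.prof.El (𝟙_ FintypeCat) (expo X Y)) =>
      P.prof.act (λ_ X).inv (ev X Y) (P.str X p))
    (fun {X X' Y Y'} f g (p : P.prof.El (𝟙_ FintypeCat) (expo X Y)) => by
      change P.prof.act (λ_ X').inv (ev X' Y')
        (P.str X' (P.prof.act (𝟙 _) (expoMap f g) p)) =
          P.prof.act f g (P.prof.act (λ_ X).inv (ev X Y) (P.str X p))
      have e := congrArg (P.prof.act (λ_ X').inv (ev X Y ≫ g)) (P.str_dinatural f p)
      rw [P.str_natural, act_act, act_act]
      rw [act_act, act_act] at e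
      exact e)
    (fun {X Y} Z (p : P.prof.El (𝟙_ FintypeCat) (expo X Y)) => by
      change P.prof.act (λ_ (X ⊗ Z)).inv (ev (X ⊗ Z) (Y ⊗ Z))
        (P.str (X ⊗ Z) (P.prof.act (𝟙 _) (expoStr X Y Z) p)) =
          P.str Z (P.prof.act (λ_ X).inv (ev X Y) (P.str X p))
      rw [P.str_natural, P.str_natural, P.str_assoc, act_act, act_act]
      rfl)

/-- The Cayley adjunction `(-)^! ⊣ (-)_*`. -/
def cayleyAdjunction : cayley.{u} ⊣ restrict.{u} where
  unit :=
    { app := cayleyUnit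
      naturality := fun F G τ => by
        ext Z v
        exact (NatTrans.naturality_apply τ.natTrans (curry (ρ_ Z).hom) v).symm }
  counit :=
    { app := cayleyCounit
      naturality := fun P Q τ => hom_ext fun {X Y} (p : P.prof.El (𝟙_ FintypeCat) (expo X Y)) => by
        change Q.prof.act (λ_ X).inv (ev X Y) (Q.str X (app τ p)) =
          app τ (P.prof.act (λ_ X).inv (ev X Y) (P.str X p))
        rw [app_act, app_str] }
  left_triangle_components F := hom_ext fun {X Y} (v : F.functor.obj (expo X Y)) => by
    change F.functor.map (expoMap (λ_ X).inv (ev X Y))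
      (F.functor.map (expoStr (𝟙_ FintypeCat) (expo X Y) X)
        (F.functor.map (curry (ρ_ (expo X Y)).hom) v)) = v
    rw [map_map, map_map]
    exact congrArg (fun k => k v) (F.functor.map_id (expo X Y))
  right_triangle_components P := by
    ext Z (p : P.prof.El (𝟙_ FintypeCat) Z)
    change P.prof.act (λ_ (𝟙_ FintypeCat)).inv (ev (𝟙_ FintypeCat) Z)
      (P.str (𝟙_ FintypeCat) (P.prof.act (𝟙 _) (curry (ρ_ Z).hom) p)) = p
    have e := congrArg (P.prof.act (λ_ (𝟙_ FintypeCat)).inv (𝟙 Z)) (P.str_one p)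
    rw [act_act, act_act] at e
    rw [P.str_natural, act_act]
    refine Eq.trans ?_ (e.trans (P.prof.act_id p))
    rfl

end StrongProf

/-!
The Cayley functor is shown to be strong monoidal; the rest is doctrinal adjunction. The right
adjoint `(-)_*` of a strong monoidal functor inherits a lax monoidal structure, with structure maps
the transposes of the inverses of those of the left adjoint, and for this structure the unit and
the counit are monoidal (`Adjunction.rightAdjointLaxMonoidal` and the instances on
`NatTrans.IsMonoidal` that go with it).

All the coends are handled through generators. An element of `(F ⋆ G)(Z)` has the form
`(F ⋆ G)(k)(v ⋆ w)` with `v ∈ F(C)`, `w ∈ G(D)` and `k : C × D ⟶ Z`, and an element of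
`(F^! ⊗ G^!)(X, Y)` is a pair of some `v ∈ F(X → W)` and `w ∈ G(W → Y)`.

The tensorator `F^! ⊗ G^! ⟶ (F ⋆ G)^!` (`cayleyμ`) sends such a pair to the image of `v ⋆ w` under
the composition `(X → W) × (W → Y) ⟶ (X → Y)`. Its inverse (`cayleyδ`) sends the element given by
`v ∈ F(C)`, `w ∈ G(D)` and `k : C × D ⟶ (X → Y)` to a pair at `W = C × X`: the image of `v` under
the coevaluation `C ⟶ (X → C × X)`, and the image of `w` under the map `D ⟶ (C × X → Y)`
corresponding to `k`. That this is well defined and strong needs no separate argument, because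
it is the transpose under the Cayley adjunction of a morphism out of `F ⋆ G`. One composite is the
identity by the triangle identity for exponentials; for the other, the coend relation along the
evaluation `(X → W) × X ⟶ W` is used first. Associativity of the tensorator comes down to
associativity of the composition of functions.

The unit comparison `Hom ⟶ 1^!` (`cayleyε`), with `1` the unit of Day convolution, sends a map
`X ⟶ Y` to its name, a point of `X → Y`; it is invertible because the unit of Day convolution is
freely generated by one element at the one-point set.
-/

/-! ### Elements of Day convolutions -/

namespace FinitaryDay

open LawfulDayConvolutionMonoidalCategoryStruct

/-- The element `v ⋆ w` of `(F ⋆ G)(C × D)` given by `v ∈ F(C)` and `w ∈ G(D)`. -/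
noncomputable def pair {F G : FinitaryDay.{u}} {C D : FintypeCat.{u}} (v : F.functor.obj C)
    (w : G.functor.obj D) : (F ⊗ G).functor.obj (C ⊗ D) :=
  (DayFunctor.η F G).app (C, D) ((v, w) : F.functor.obj C × G.functor.obj D)

theorem map_pair {F G : FinitaryDay.{u}} {C C' D D' : FintypeCat.{u}} (f : C ⟶ C') (g : D ⟶ D')
    (v : F.functor.obj C) (w : G.functor.obj D) :
    (F ⊗ G).functor.map (f ⊗ₘ g) (pair v w) = pair (F.functor.map f v) (G.functor.map g w) := by
  have h := (DayFunctor.η F G).naturality (X := (C, D)) (Y := (C', D')) (f, g)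
  exact (congrArg (fun k => k ((v, w) : F.functor.obj C × G.functor.obj D)) h).symm

/-- Arguments of a pair can be moved along maps of finite sets into the map applied to the pair. -/
theorem map_pair_map {F G : FinitaryDay.{u}} {C C' D D' Z : FintypeCat.{u}} (f : C ⟶ C')
    (g : D ⟶ D') (k : C' ⊗ D' ⟶ Z) (v : F.functor.obj C) (w : G.functor.obj D) :
    (F ⊗ G).functor.map k (pair (F.functor.map f v) (G.functor.map g w)) =
      (F ⊗ G).functor.map ((f ⊗ₘ g) ≫ k) (pair v w) := by
  rw [← map_pair, StrongProf.map_map]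

theorem map_pair_map_left {F G : FinitaryDay.{u}} {C C' D Z : FintypeCat.{u}} (f : C ⟶ C')
    (k : C' ⊗ D ⟶ Z) (v : F.functor.obj C) (w : G.functor.obj D) :
    (F ⊗ G).functor.map k (pair (F.functor.map f v) w) =
      (F ⊗ G).functor.map ((f ▷ D) ≫ k) (pair v w) := by
  simpa using map_pair_map f (𝟙 D) k v w

theorem map_pair_map_right {F G : FinitaryDay.{u}} {C D D' Z : FintypeCat.{u}} (g : D ⟶ D')
    (k : C ⊗ D' ⟶ Z) (v : F.functor.obj C) (w : G.functor.obj D) :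
    (F ⊗ G).functor.map k (pair v (G.functor.map g w)) =
      (F ⊗ G).functor.map ((C ◁ g) ≫ k) (pair v w) := by
  simpa using map_pair_map (𝟙 C) g k v w

/-- Pairs generate a Day convolution, which is a pointwise left Kan extension. -/
theorem exists_map_pair {F G : FinitaryDay.{u}} {Z : FintypeCat.{u}}
    (t : (F ⊗ G).functor.obj Z) :
    ∃ (C D : FintypeCat.{u}) (v : F.functor.obj C) (w : G.functor.obj D) (k : C ⊗ D ⟶ Z),
      t = (F ⊗ G).functor.map k (pair v w) := by
  obtain ⟨j, s, rfl⟩ := Types.jointly_surjective_of_isColimit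
    (isPointwiseLeftKanExtensionConvolutionExtensionUnit (C := FintypeCat.{u}) (V := Type u) F G Z) t
  exact ⟨j.left.1, j.left.2, s.1, s.2, j.hom, rfl⟩

theorem whiskerRight_pair {F F' : FinitaryDay.{u}} (σ : F ⟶ F') (G : FinitaryDay.{u})
    {C D : FintypeCat.{u}} (v : F.functor.obj C) (w : G.functor.obj D) :
    (σ ▷ G).natTrans.app (C ⊗ D) (pair v w) = pair (σ.natTrans.app C v) w :=
  congrArg (fun k => k ((v, w) : F.functor.obj C × G.functor.obj D))
    (convolutionExtensionUnit_comp_ι_map_whiskerRight_app FintypeCat.{u} (Type u) σ G C D)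

theorem whiskerLeft_pair (F : FinitaryDay.{u}) {G G' : FinitaryDay.{u}} (τ : G ⟶ G')
    {C D : FintypeCat.{u}} (v : F.functor.obj C) (w : G.functor.obj D) :
    (F ◁ τ).natTrans.app (C ⊗ D) (pair v w) = pair v (τ.natTrans.app D w) :=
  congrArg (fun k => k ((v, w) : F.functor.obj C × G.functor.obj D))
    (convolutionExtensionUnit_comp_ι_map_whiskerLeft_app (Type u) F τ C D)

theorem associator_pair (F G H : FinitaryDay.{u}) {C D E : FintypeCat.{u}}
    (v : F.functor.obj C) (w : G.functor.obj D) (x : H.functor.obj E) :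
    (α_ F G H).hom.natTrans.app ((C ⊗ D) ⊗ E) (pair (pair v w) x) =
      (F ⊗ G ⊗ H).functor.map (α_ C D E).inv (pair v (pair w x)) :=
  congrArg (fun k => k (((v, w), x) : (F.functor.obj C × G.functor.obj D) × H.functor.obj E))
    (associator_hom_unit_unit (Type u) F G H C D E)

/-- The generator of the Day convolution unit, an element of its value at `1`. -/
noncomputable def point : (𝟙_ FinitaryDay.{u}).functor.obj (𝟙_ FintypeCat.{u}) :=
  DayFunctor.ν FintypeCat.{u} (Type u) PUnit.unit

/-- The Day convolution unit is generated by its point. -/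
theorem exists_map_point {Z : FintypeCat.{u}} (t : (𝟙_ FinitaryDay.{u}).functor.obj Z) :
    ∃ k : 𝟙_ FintypeCat.{u} ⟶ Z, t = (𝟙_ FinitaryDay.{u}).functor.map k point := by
  obtain ⟨j, s, rfl⟩ := Types.jointly_surjective_of_isColimit
    (isPointwiseLeftKanExtensionUnitUnit FintypeCat.{u} (Type u) FinitaryDay.{u} Z) t
  exact ⟨j.hom, rfl⟩

theorem leftUnitor_pair (F : FinitaryDay.{u}) {C : FintypeCat.{u}} (v : F.functor.obj C) :
    (λ_ F).hom.natTrans.app (𝟙_ FintypeCat.{u} ⊗ C) (pair point v) =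
      F.functor.map (λ_ C).inv v :=
  congrArg (fun k => k ((PUnit.unit, v) : PUnit × F.functor.obj C))
    (leftUnitor_hom_unit_app (Type u) F C)

theorem rightUnitor_pair (F : FinitaryDay.{u}) {C : FintypeCat.{u}} (v : F.functor.obj C) :
    (ρ_ F).hom.natTrans.app (C ⊗ 𝟙_ FintypeCat.{u}) (pair v point) =
      F.functor.map (ρ_ C).inv v :=
  congrArg (fun k => k ((v, PUnit.unit) : F.functor.obj C × PUnit))
    (rightUnitor_hom_unit_app (Type u) F C)

/-- A family of maps `F(C) × G(D) → H(C × D)`, natural in `C` and `D`, induces a morphism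
`F ⋆ G ⟶ H`. -/
noncomputable def desc {F G H : FinitaryDay.{u}}
    (t : ∀ C D : FintypeCat.{u}, F.functor.obj C → G.functor.obj D → H.functor.obj (C ⊗ D))
    (ht : ∀ {C C' D D' : FintypeCat.{u}} (f : C ⟶ C') (g : D ⟶ D') (v : F.functor.obj C)
      (w : G.functor.obj D),
      t C' D' (F.functor.map f v) (G.functor.map g w) = H.functor.map (f ⊗ₘ g) (t C D v w)) :
    F ⊗ G ⟶ H :=
  DayFunctor.tensorDesc
    { app := fun A => ↾(fun s : F.functor.obj A.1 × G.functor.obj A.2 => t A.1 A.2 s.1 s.2)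
      naturality := fun A B k => by
        ext s
        exact ht k.1 k.2 s.1 s.2 }

theorem desc_pair {F G H : FinitaryDay.{u}}
    (t : ∀ C D : FintypeCat.{u}, F.functor.obj C → G.functor.obj D → H.functor.obj (C ⊗ D))
    (ht : ∀ {C C' D D' : FintypeCat.{u}} (f : C ⟶ C') (g : D ⟶ D') (v : F.functor.obj C)
      (w : G.functor.obj D),
      t C' D' (F.functor.map f v) (G.functor.map g w) = H.functor.map (f ⊗ₘ g) (t C D v w))
    {C D : FintypeCat.{u}} (v : F.functor.obj C) (w : G.functor.obj D) :
    (desc t ht).natTrans.app (C ⊗ D) (pair v w) = t C D v w :=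
  congrArg (fun k => k ((v, w) : F.functor.obj C × G.functor.obj D))
    (DayFunctor.η_comp_tensorDesc_app (F := F) (G := G) (H := H) _ C D)

/-- An element of `F(1)` induces a morphism from the Day convolution unit to `F`. -/
noncomputable def unitDesc {F : FinitaryDay.{u}} (v : F.functor.obj (𝟙_ FintypeCat.{u})) :
    𝟙_ FinitaryDay.{u} ⟶ F :=
  DayFunctor.unitDesc (↾(fun _ : PUnit => v))

theorem unitDesc_point {F : FinitaryDay.{u}} (v : F.functor.obj (𝟙_ FintypeCat.{u})) :
    (unitDesc v).natTrans.app (𝟙_ FintypeCat.{u}) point = v :=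
  congrArg (fun k => k PUnit.unit)
    (DayFunctor.ν_comp_unitDesc (C := FintypeCat.{u}) (F := F) (↾(fun _ : PUnit => v)))

end FinitaryDay

/-! ### Maps between exponentials -/

namespace FintypeCat

/-- The composition `(X → W) × (W → Y) ⟶ (X → Y)`, in diagrammatic order. -/
def expoComp (X W Y : FintypeCat.{u}) : expo X W ⊗ expo W Y ⟶ expo X Y :=
  homMk (X := expo X W ⊗ expo W Y) (Y := expo X Y) fun p : (X → W) × (W → Y) => p.2 ∘ p.1

/-- The coevaluation `C ⟶ (X → C × X)`. -/
def coev (C X : FintypeCat.{u}) : C ⟶ expo X (C ⊗ X) :=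
  curry (𝟙 (C ⊗ X))

/-- The coevaluation `D ⟶ (C → C × D)` in the other variable. -/
def coevRight (C D : FintypeCat.{u}) : D ⟶ expo C (C ⊗ D) :=
  homMk (X := D) (Y := expo C (C ⊗ D)) fun d c => ((c, d) : C × D)

/-- The map `D ⟶ (C × X → Y)` corresponding to `C × D ⟶ (X → Y)`. -/
def shift {C D X Y : FintypeCat.{u}} (k : C ⊗ D ⟶ expo X Y) : D ⟶ expo (C ⊗ X) Y :=
  homMk (X := D) (Y := expo (C ⊗ X) Y) fun d (p : C × X) =>
    (show X → Y from k ((p.1, d) : C × D)) p.2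

/-- The element of `X → Y` named by a map `X ⟶ Y`. -/
def name {X Y : FintypeCat.{u}} (f : X ⟶ Y) : 𝟙_ FintypeCat.{u} ⟶ expo X Y :=
  curry ((λ_ X).hom ≫ f)

end FintypeCat

namespace StrongProf

open FintypeCat

/-! ### Elements of the image of the Cayley functor -/

/-- An element of `F(X → Y)`, as an element of `F^!(X, Y)`. -/
def toCayley {F : FinitaryDay.{u}} {X Y : FintypeCat.{u}} (v : F.functor.obj (expo X Y)) :
    (cayley.obj F).prof.El X Y := v

/-- An element of `F^!(X, Y)`, as an element of `F(X → Y)`. -/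
def ofCayley {F : FinitaryDay.{u}} {X Y : FintypeCat.{u}} (v : (cayley.obj F).prof.El X Y) :
    F.functor.obj (expo X Y) := v

theorem toCayley_surjective {F : FinitaryDay.{u}} {X Y : FintypeCat.{u}}
    (s : (cayley.obj F).prof.El X Y) : ∃ v : F.functor.obj (expo X Y), toCayley v = s :=
  ⟨s, rfl⟩

@[simp]
theorem ofCayley_toCayley {F : FinitaryDay.{u}} {X Y : FintypeCat.{u}}
    (v : F.functor.obj (expo X Y)) : ofCayley (toCayley v) = v :=
  rfl

theorem act_toCayley {F : FinitaryDay.{u}} {X X' Y Y' : FintypeCat.{u}} (f : X' ⟶ X)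
    (g : Y ⟶ Y') (v : F.functor.obj (expo X Y)) :
    (cayley.obj F).prof.act f g (toCayley v) = toCayley (F.functor.map (expoMap f g) v) :=
  rfl

theorem str_toCayley {F : FinitaryDay.{u}} {X Y : FintypeCat.{u}} (Z : FintypeCat.{u})
    (v : F.functor.obj (expo X Y)) :
    (cayley.obj F).str Z (toCayley v) = toCayley (F.functor.map (expoStr X Y Z) v) :=
  rfl

theorem app_cayley_map {F G : FinitaryDay.{u}} (τ : F ⟶ G) {X Y : FintypeCat.{u}}
    (v : F.functor.obj (expo X Y)) :
    app (cayley.map τ) (toCayley v) = toCayley (τ.natTrans.app (expo X Y) v) :=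
  rfl

/-- Naturality of `τ`, for the image under `τ^!` of an element of `F(X → Y)` that comes from
some `F(A)`. -/
theorem app_cayley_map_map {F G : FinitaryDay.{u}} (τ : F ⟶ G) {A X Y : FintypeCat.{u}}
    (k : A ⟶ expo X Y) (v : F.functor.obj A) :
    app (cayley.map τ) (toCayley (F.functor.map k v)) =
      toCayley (G.functor.map k (τ.natTrans.app A v)) :=
  NatTrans.naturality_apply τ.natTrans k v

/-- The value at `F.map k v` of the transpose `F^! ⟶ P` of a morphism `τ : F ⟶ P_*`, in terms of
the element `p` of `P(1, A)` to which `τ` sends `v`. -/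
theorem app_transpose {F : FinitaryDay.{u}} {P : StrongProf.{u}} (τ : F ⟶ restrict.obj P)
    {A X Y : FintypeCat.{u}} (k : A ⟶ expo X Y) (v : F.functor.obj A)
    {p : P.prof.El (𝟙_ FintypeCat) A} (hp : τ.natTrans.app A v = p) :
    app (cayley.map τ ≫ cayleyCounit P) (toCayley (F.functor.map k v)) =
      P.prof.act (λ_ X).inv (ev X Y)
        (P.str X (P.prof.act (𝟙 (𝟙_ FintypeCat)) k p)) := by
  subst hp
  exact congrArg (app (cayleyCounit P)) (app_cayley_map_map τ k v)

/-! ### The tensorator of the Cayley functor -/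

/-- The tensorator `F^! ⊗ G^! ⟶ (F ⋆ G)^!`, induced by the composition of functions. -/
noncomputable def cayleyμ (F G : FinitaryDay.{u}) :
    tensorObj (cayley.obj F) (cayley.obj G) ⟶ cayley.obj (F ⊗ G) :=
  tensorDesc
    (fun X W Y v w => toCayley
      ((F ⊗ G).functor.map (expoComp X W Y) (FinitaryDay.pair (ofCayley v) (ofCayley w))))
    (fun X W W' Y h v w => by
      obtain ⟨v, rfl⟩ := toCayley_surjective v
      obtain ⟨w, rfl⟩ := toCayley_surjective w
      simp only [act_toCayley, ofCayley_toCayley, FinitaryDay.map_pair_map_left,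
        FinitaryDay.map_pair_map_right]
      rfl)
    (fun X X' W Y Y' f g v w => by
      obtain ⟨v, rfl⟩ := toCayley_surjective v
      obtain ⟨w, rfl⟩ := toCayley_surjective w
      simp only [act_toCayley, ofCayley_toCayley, FinitaryDay.map_pair_map, map_map]
      rfl)
    (fun X W Y Z v w => by
      obtain ⟨v, rfl⟩ := toCayley_surjective v
      obtain ⟨w, rfl⟩ := toCayley_surjective w
      simp only [str_toCayley, ofCayley_toCayley, FinitaryDay.map_pair_map, map_map]
      rfl)

theorem app_cayleyμ (F G : FinitaryDay.{u}) {X W Y : FintypeCat.{u}}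
    (v : F.functor.obj (expo X W)) (w : G.functor.obj (expo W Y)) :
    app (cayleyμ F G) (pair (toCayley v) (toCayley w)) =
      toCayley ((F ⊗ G).functor.map (expoComp X W Y) (FinitaryDay.pair v w)) :=
  app_tensorDesc _ _ _ _ (toCayley v) (toCayley w)

/-- For `v ∈ F(C)` and `w ∈ G(D)`, the element of `(F^! ⊗ G^!)(1, C × D)` that pairs, at `C`, the
elements of `F(1 → C)` and `G(C → C × D)` induced by `v` and `w`. -/
noncomputable def cayleyPair {F G : FinitaryDay.{u}} {C D : FintypeCat.{u}} (v : F.functor.obj C)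
    (w : G.functor.obj D) :
    (tensorObj (cayley.obj F) (cayley.obj G)).prof.El (𝟙_ FintypeCat) (C ⊗ D) :=
  pair (toCayley (F.functor.map (curry (ρ_ C).hom) v)) (toCayley (G.functor.map (coevRight C D) w))

theorem cayleyPair_natural {F G : FinitaryDay.{u}} {C C' D D' : FintypeCat.{u}} (f : C ⟶ C')
    (g : D ⟶ D') (v : F.functor.obj C) (w : G.functor.obj D) :
    cayleyPair (F.functor.map f v) (G.functor.map g w) =
      (tensorObj (cayley.obj F) (cayley.obj G)).prof.act (𝟙 (𝟙_ FintypeCat)) (f ⊗ₘ g)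
        (cayleyPair v w) := by
  have hv : toCayley (F.functor.map (curry (ρ_ C').hom) (F.functor.map f v)) =
      (cayley.obj F).prof.act (𝟙 (𝟙_ FintypeCat)) f
        (toCayley (F.functor.map (curry (ρ_ C).hom) v)) :=
    congrArg toCayley (map_square F.functor (f := f) (g := curry (ρ_ C').hom)
      (f' := curry (ρ_ C).hom) (g' := expoMap (𝟙 (𝟙_ FintypeCat)) f) rfl v)
  -- Once `f` has moved across the coend, both second components are images of `w` along
  -- `d ↦ (c ↦ (f c, g d))`.
  rw [cayleyPair, cayleyPair, hv, ← pair_act, act_pair, Endoprof.act_id]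
  simp only [act_toCayley, map_map]
  rfl

/-- The transpose `F ⋆ G ⟶ (F^! ⊗ G^!)_*` of the inverse of the tensorator. -/
noncomputable def cayleyδTranspose (F G : FinitaryDay.{u}) :
    F ⊗ G ⟶ restrict.obj (tensorObj (cayley.obj F) (cayley.obj G)) :=
  FinitaryDay.desc (H := restrict.obj (tensorObj (cayley.obj F) (cayley.obj G)))
    (fun _ _ v w => cayleyPair v w) cayleyPair_natural

/-- The inverse `(F ⋆ G)^! ⟶ F^! ⊗ G^!` of the tensorator. -/
noncomputable def cayleyδ (F G : FinitaryDay.{u}) :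
    cayley.obj (F ⊗ G) ⟶ tensorObj (cayley.obj F) (cayley.obj G) :=
  cayley.map (cayleyδTranspose F G) ≫ cayleyCounit (tensorObj (cayley.obj F) (cayley.obj G))

/-- The inverse of the tensorator sends the element of `(F ⋆ G)(X → Y)` given by `v ∈ F(C)`,
`w ∈ G(D)` and `k : C × D ⟶ (X → Y)` to a pair at `C × X`. -/
theorem app_cayleyδ (F G : FinitaryDay.{u}) {C D X Y : FintypeCat.{u}}
    (k : C ⊗ D ⟶ expo X Y) (v : F.functor.obj C) (w : G.functor.obj D) :
    app (cayleyδ F G) (toCayley ((F ⊗ G).functor.map k (FinitaryDay.pair v w))) =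
      pair (toCayley (F.functor.map (coev C X) v)) (toCayley (G.functor.map (shift k) w)) := by
  refine (app_transpose (cayleyδTranspose F G) k (FinitaryDay.pair v w)
    (FinitaryDay.desc_pair _ cayleyPair_natural v w)).trans ?_
  rw [cayleyPair, act_pair, str_pair, act_pair, Endoprof.act_id]
  simp only [act_toCayley, str_toCayley, map_map]
  rfl

/-- The tensorator as an isomorphism. -/
noncomputable def cayleyμIso (F G : FinitaryDay.{u}) :
    cayley.obj F ⊗ cayley.obj G ≅ cayley.obj (F ⊗ G) where
  hom := cayleyμ F G
  inv := cayleyδ F G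
  hom_inv_id := tensorObj_ext fun {X W Y} v w => by
    obtain ⟨v, rfl⟩ := toCayley_surjective v
    obtain ⟨w, rfl⟩ := toCayley_surjective w
    -- The two pairs are related by the evaluation `(X → W) × X ⟶ W` in the coend.
    have e := pair_act (ev X W) (toCayley (F.functor.map (coev (expo X W) X) v)) (toCayley w)
    have hv : F.functor.map (coev (expo X W) X ≫ expoMap (𝟙 X) (ev X W)) v = v :=
      congrArg (fun k => k v) (F.functor.map_id (expo X W))
    rw [act_toCayley, act_toCayley, map_map, hv] at e
    rw [app_comp, app_cayleyμ, app_cayleyδ]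
    exact e
  inv_hom_id := hom_ext fun {X Y} t => by
    obtain ⟨t, rfl⟩ := toCayley_surjective t
    obtain ⟨C, D, v, w, k, rfl⟩ := FinitaryDay.exists_map_pair t
    rw [app_comp, app_cayleyδ, app_cayleyμ, FinitaryDay.map_pair_map]
    rfl

/-! ### The unit isomorphism of the Cayley functor -/

/-- The comparison of units `Hom ⟶ 1^!`, sending a map to its name. -/
noncomputable def cayleyε : tensorUnit.{u} ⟶ cayley.obj (𝟙_ FinitaryDay.{u}) :=
  homMk
    (fun f => toCayley ((𝟙_ FinitaryDay.{u}).functor.map (name (elHom f)) FinitaryDay.point))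
    (fun f g k => by rw [act_toCayley, map_map]; rfl)
    (fun Z k => by rw [str_toCayley, map_map]; rfl)

theorem app_cayleyε {X Y : FintypeCat.{u}} (f : tensorUnit.{u}.prof.El X Y) :
    app cayleyε f =
      toCayley ((𝟙_ FinitaryDay.{u}).functor.map (name (elHom f)) FinitaryDay.point) :=
  rfl

/-- The inverse `1^! ⟶ Hom` of the comparison of units, the transpose of the morphism
`1 ⟶ Hom_*` given by the identity of the one-point set. -/
noncomputable def cayleyη : cayley.obj (𝟙_ FinitaryDay.{u}) ⟶ tensorUnit.{u} :=
  cayley.map (FinitaryDay.unitDesc (F := restrict.obj tensorUnit.{u})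
    (homEl (𝟙 (𝟙_ FintypeCat.{u})))) ≫ cayleyCounit tensorUnit.{u}

theorem app_cayleyη {X Y : FintypeCat.{u}} (k : 𝟙_ FintypeCat.{u} ⟶ expo X Y) :
    app cayleyη (toCayley ((𝟙_ FinitaryDay.{u}).functor.map k FinitaryDay.point)) =
      homEl ((λ_ X).inv ≫ k ▷ X ≫ ev X Y) :=
  app_transpose _ k FinitaryDay.point (FinitaryDay.unitDesc_point _)

/-- The comparison of units as an isomorphism. -/
noncomputable def cayleyεIso : 𝟙_ StrongProf.{u} ≅ cayley.obj (𝟙_ FinitaryDay.{u}) where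
  hom := cayleyε
  inv := cayleyη
  hom_inv_id := hom_ext (P := tensorUnit) fun {X Y} f => app_cayleyη (name (elHom f))
  inv_hom_id := hom_ext fun {X Y} t => by
    obtain ⟨t, rfl⟩ := toCayley_surjective t
    obtain ⟨k, rfl⟩ := FinitaryDay.exists_map_point t
    rw [app_comp, app_cayleyη, app_cayleyε]
    rfl

/-! ### The strong monoidal structure -/

/-- The strong monoidal structure of the Cayley functor, with tensorator `cayleyμ` and unit
comparison `cayleyε`. The axioms are checked on pairs. -/
noncomputable def cayleyCoreMonoidal : cayley.{u}.CoreMonoidal where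
  εIso := cayleyεIso
  μIso := cayleyμIso
  μIso_hom_natural_left {F F'} τ G := tensorObj_ext fun v w => by
    obtain ⟨v, rfl⟩ := toCayley_surjective v
    obtain ⟨w, rfl⟩ := toCayley_surjective w
    change app (tensorMap (cayley.map τ) (𝟙 (cayley.obj G)) ≫ cayleyμ F' G) _ =
      app (cayleyμ F G ≫ cayley.map (τ ▷ G)) _
    rw [app_comp, app_comp, app_tensorMap, app_id, app_cayley_map, app_cayleyμ, app_cayleyμ,
      app_cayley_map_map, FinitaryDay.whiskerRight_pair]
  μIso_hom_natural_right {G G'} F τ := tensorObj_ext fun v w => by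
    obtain ⟨v, rfl⟩ := toCayley_surjective v
    obtain ⟨w, rfl⟩ := toCayley_surjective w
    change app (tensorMap (𝟙 (cayley.obj F)) (cayley.map τ) ≫ cayleyμ F G') _ =
      app (cayleyμ F G ≫ cayley.map (F ◁ τ)) _
    rw [app_comp, app_comp, app_tensorMap, app_id, app_cayley_map, app_cayleyμ, app_cayleyμ,
      app_cayley_map_map, FinitaryDay.whiskerLeft_pair]
  associativity F G H := tensorObj_ext_left fun v w x => by
    obtain ⟨v, rfl⟩ := toCayley_surjective v
    obtain ⟨w, rfl⟩ := toCayley_surjective w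
    obtain ⟨x, rfl⟩ := toCayley_surjective x
    change app (tensorMap (cayleyμ F G) (𝟙 (cayley.obj H)) ≫ cayleyμ (F ⊗ G) H ≫
        cayley.map (α_ F G H).hom) _ =
      app (assocHom _ _ _ ≫ tensorMap (𝟙 (cayley.obj F)) (cayleyμ G H) ≫ cayleyμ F (G ⊗ H)) _
    simp only [app_comp, app_assocHom, app_tensorMap, app_cayleyμ, app_id,
      FinitaryDay.map_pair_map_left, FinitaryDay.map_pair_map_right, app_cayley_map_map,
      FinitaryDay.associator_pair, map_map]
    -- Both sides are now images of `(v, (w, x))`, along equal maps: composition is associative.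
    rfl
  left_unitality F := tensorObj_ext (P := tensorUnit) (Q := cayley.obj F) fun {X W Y} f v => by
    obtain ⟨v, rfl⟩ := toCayley_surjective v
    change app (leftUnitorHom (cayley.obj F)) _ =
      app (tensorMap cayleyε (𝟙 (cayley.obj F)) ≫ cayleyμ (𝟙_ FinitaryDay.{u}) F ≫
        cayley.map (λ_ F).hom) _
    rw [app_comp, app_comp, app_tensorMap, app_leftUnitorHom, app_id, app_cayleyε, app_cayleyμ,
      FinitaryDay.map_pair_map_left, app_cayley_map_map, FinitaryDay.leftUnitor_pair, map_map]
    rfl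
  right_unitality F := tensorObj_ext (P := cayley.obj F) (Q := tensorUnit) fun {X W Y} v f => by
    obtain ⟨v, rfl⟩ := toCayley_surjective v
    change app (rightUnitorHom (cayley.obj F)) _ =
      app (tensorMap (𝟙 (cayley.obj F)) cayleyε ≫ cayleyμ F (𝟙_ FinitaryDay.{u}) ≫
        cayley.map (ρ_ F).hom) _
    rw [app_comp, app_comp, app_tensorMap, app_rightUnitorHom, app_id, app_cayleyε, app_cayleyμ,
      FinitaryDay.map_pair_map_right, app_cayley_map_map, FinitaryDay.rightUnitor_pair, map_map]
    rfl

end StrongProf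

theorem mainTheorem6 :
    ∃ (_ : StrongProf.cayley.{u}.Monoidal) (_ : StrongProf.restrict.{u}.LaxMonoidal),
      NatTrans.IsMonoidal StrongProf.cayleyAdjunction.{u}.unit ∧
        NatTrans.IsMonoidal StrongProf.cayleyAdjunction.{u}.counit := by
  let _ := StrongProf.cayleyCoreMonoidal.{u}.toMonoidal
  let _ := StrongProf.cayleyAdjunction.{u}.rightAdjointLaxMonoidal
  exact ⟨inferInstance, inferInstance, inferInstance, inferInstance⟩
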